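/- Let $k\ge 1$ be an integer and let $r_k(n)$ denote the number of representations of $n$ as a sum of $k$ squares of integers (order and signs counted). Put $\nu=\frac k4-\frac12$. Let $J_\nu$ and $I_\nu$ be the Bessel and modified Bessel functions of the first kind, $$J_\nu(z)=\Big(\frac z2\Big)^{\nu}\sum_{m\ge 0}\frac{(-1)^m (z/2)^{2m}}{m!\,\Gamma(\nu+m+1)},\qquad I_\nu(z)=\Big(\frac z2\Big)^{\nu}\sum_{m\ge 0}\frac{(z/2)^{2m}}{m!\,\Gamma(\nu+m+1)}.$$ Let $x,y\in\mathbb C$, with $y\ne 0$ if $k=1$. (i) If $\operatorname{Re}(x)>|\operatorname{Im}(y)|$, then $$\frac{(\pi y)^{\nu}}{2^{\nu}\Gamma(\frac k4+\frac12)}+\sum_{n=1}^\infty \frac{r_k(n)}{n^{\nu}}e^{-\pi n x}J_\nu(\pi n y)=\frac{(\pi y)^{\nu}}{2^{\nu}\Gamma(\frac k4+\frac12)\,(x^2+y^2)^{k/4}}+\frac1{\sqrt{x^2+y^2}}\sum_{n=1}^\infty \frac{r_k(n)}{n^{\nu}}e^{-\frac{\pi n x}{x^2+y^2}}J_\nu\Big(\frac{\pi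 n y}{x^2+y^2}\Big).$$ (ii) If $\operatorname{Re}(x)>|\operatorname{Re}(y)|$, then $$\frac{(\pi y)^{\nu}}{2^{\nu}\Gamma(\frac k4+\frac12)}+\sum_{n=1}^\infty \frac{r_k(n)}{n^{\nu}}e^{-\pi n x}I_\nu(\pi n y)=\frac{(\pi y)^{\nu}}{2^{\nu}\Gamma(\frac k4+\frac12)\,(x^2-y^2)^{k/4}}+\frac1{\sqrt{x^2-y^2}}\sum_{n=1}^\infty \frac{r_k(n)}{n^{\nu}}e^{-\frac{\pi n x}{x^2-y^2}}I_\nu\Big(\frac{\pi n y}{x^2-y^2}\Big).$$ All four series converge absolutely. The branches are as follows. With $D=x^2+y^2$ in (i) and $D=x^2-y^2$ in (ii), $\sqrt D$ and $D^{k/4}$ have their principal values. An arbitrary determination $\theta$ of $\arg y$ is fixed; $(\pi y)^\nu$ and the factor $(\pi n y/2)^\nu$ of the Bessel functions on the left are taken with $\theta$, and the factor $(\pi n y/(2D))^\nu$ of the Bessel functions on the right is taken with $\theta-\operatorname{Arg} D$, where $\operatorname{Arg}$ is the principal argument. -/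

import Mathlib

noncomputable section

/-- `r_k(n)`: the number of representations of `n` as a sum of `k` squares of integers
(order and signs matter). -/
def sumSqReps (k n : ℕ) : ℕ :=
  Set.ncard {v : Fin k → ℤ | ∑ i, v i ^ 2 = (n : ℤ)}

/-- The set counted by `sumSqReps` is finite, so that its cardinality is the true one. -/
theorem sumSqReps_finite (k n : ℕ) : {v : Fin k → ℤ | ∑ i, v i ^ 2 = (n : ℤ)}.Finite := by
  refine (Set.finite_Icc (fun _ : Fin k => -(n : ℤ)) (fun _ => (n : ℤ))).subset ?_
  intro v hv
  have hv' : ∑ i, v i ^ 2 = (n : ℤ) := hv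
  have key : ∀ i, v i ^ 2 ≤ (n : ℤ) := fun i => by
    rw [← hv']
    exact Finset.single_le_sum (f := fun j => v j ^ 2) (fun j _ => sq_nonneg _)
      (Finset.mem_univ i)
  refine ⟨fun i => ?_, fun i => ?_⟩
  · show -(n : ℤ) ≤ v i
    have := key i
    nlinarith [sq_nonneg (v i + 1), Int.le_self_sq (-(v i))]
  · show v i ≤ (n : ℤ)
    exact (Int.le_self_sq (v i)).trans (key i)

/-- `θ` is a determination of the argument of `z` (every real number is one if `z = 0`). -/
def IsArgOf (θ : ℝ) (z : ℂ) : Prop :=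
  (‖z‖ : ℂ) * Complex.exp (θ * Complex.I) = z

/-- The value of `z ^ ν` belonging to the determination `θ` of the argument of `z`. -/
def powAt (z : ℂ) (θ : ℝ) (ν : ℂ) : ℂ :=
  (‖z‖ : ℂ) ^ ν * Complex.exp (ν * (θ * Complex.I))

/-- The Bessel function of the first kind `J_ν(z)`; the factor `(z / 2) ^ ν` is taken with the
determination `θ` of the argument of `z`. -/
def besselJAt (ν z : ℂ) (θ : ℝ) : ℂ :=
  powAt (z / 2) θ ν *
    ∑' m : ℕ, (-1) ^ m * (z / 2) ^ (2 * m) / ((m.factorial : ℂ) * Complex.Gamma (ν + m + 1))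

/-- The modified Bessel function of the first kind `I_ν(z)`; the factor `(z / 2) ^ ν` is taken
with the determination `θ` of the argument of `z`. -/
def besselIAt (ν z : ℂ) (θ : ℝ) : ℂ :=
  powAt (z / 2) θ ν *
    ∑' m : ℕ, (z / 2) ^ (2 * m) / ((m.factorial : ℂ) * Complex.Gamma (ν + m + 1))

/-- The principal argument gives the principal power. -/
theorem powAt_arg (z ν : ℂ) : powAt z z.arg ν = z ^ ν := by
  unfold powAt
  rcases eq_or_ne z 0 with rfl | hz
  · simp
  · have hn : (‖z‖ : ℂ) ≠ 0 := by simpa using hz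
    rw [Complex.cpow_def_of_ne_zero hn, Complex.cpow_def_of_ne_zero hz, ← Complex.exp_add,
      ← Complex.ofReal_log (norm_nonneg z)]
    congr 1
    rw [Complex.log]
    ring

/-- The principal argument gives the principal value of `J_ν`. -/
theorem besselJAt_arg (ν z : ℂ) : besselJAt ν z z.arg = (z / 2) ^ ν *
    ∑' m : ℕ, (-1) ^ m * (z / 2) ^ (2 * m) /
      ((m.factorial : ℂ) * Complex.Gamma (ν + m + 1)) := by
  have h : z.arg = (z / 2).arg := by
    rw [div_eq_inv_mul, show (2⁻¹ : ℂ) = ((2⁻¹ : ℝ) : ℂ) by push_cast; rfl,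
      Complex.arg_real_mul z (by norm_num)]
  rw [besselJAt, h, powAt_arg]

/-- The principal argument gives the principal value of `I_ν`. -/
theorem besselIAt_arg (ν z : ℂ) : besselIAt ν z z.arg = (z / 2) ^ ν *
    ∑' m : ℕ, (z / 2) ^ (2 * m) / ((m.factorial : ℂ) * Complex.Gamma (ν + m + 1)) := by
  have h : z.arg = (z / 2).arg := by
    rw [div_eq_inv_mul, show (2⁻¹ : ℂ) = ((2⁻¹ : ℝ) : ℂ) by push_cast; rfl,
      Complex.arg_real_mul z (by norm_num)]
  rw [besselIAt, h, powAt_arg]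

/-- The terms, for `n ≥ 1`, of the Bessel series
`∑ r_k(n) n^(1/2 - k/4) e^(-π n X) J_(k/4 - 1/2)(π n Y)`, with the determination `θ` of the
argument of `Y`. -/
def thetaJTerm (k : ℕ) (X Y : ℂ) (θ : ℝ) (n : ℕ+) : ℂ :=
  (sumSqReps k n : ℂ) / ((n : ℕ) : ℂ) ^ ((k : ℂ) / 4 - 1 / 2) *
    Complex.exp (-(Real.pi * (n : ℕ) * X)) *
    besselJAt ((k : ℂ) / 4 - 1 / 2) (Real.pi * (n : ℕ) * Y) θ

/-- The terms, for `n ≥ 1`, of the Bessel series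
`∑ r_k(n) n^(1/2 - k/4) e^(-π n X) I_(k/4 - 1/2)(π n Y)`, with the determination `θ` of the
argument of `Y`. -/
def thetaITerm (k : ℕ) (X Y : ℂ) (θ : ℝ) (n : ℕ+) : ℂ :=
  (sumSqReps k n : ℂ) / ((n : ℕ) : ℂ) ^ ((k : ℂ) / 4 - 1 / 2) *
    Complex.exp (-(Real.pi * (n : ℕ) * X)) *
    besselIAt ((k : ℂ) / 4 - 1 / 2) (Real.pi * (n : ℕ) * Y) θ

/-- The constant term `(π y)^(k/4 - 1/2) / (2^(k/4 - 1/2) Γ(k/4 + 1/2))`, with the determination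
`θ` of the argument of `y`. -/
def thetaConst (k : ℕ) (y : ℂ) (θ : ℝ) : ℂ :=
  powAt (Real.pi * y) θ ((k : ℂ) / 4 - 1 / 2) /
    ((2 : ℂ) ^ ((k : ℂ) / 4 - 1 / 2) * Complex.Gamma ((k : ℂ) / 4 + 1 / 2))

end

/-!
Put `v = I * y` in the first part and `v = y` in the second, so that the condition on `x` and `y`
says that the ends of the segment from `x - v` to `x + v` lie in the right half-plane. Poisson's
integral, with the symmetric Beta distribution of parameter `k / 4`, shows that the Bessel series
is, up to the factor `thetaConst`, the mean over this segment of the `k`-th power of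
`∑ exp (-π m² τ)`, with the term `n = 0` removed.

The theta relation under `τ ↦ τ⁻¹` has weight `k / 2`, which is the sum of the two parameters of
the Beta distribution. For real `p, q > 0` a projective substitution of `(0, 1)` carries the mean
over the segment with ends `1 / p`, `1 / q` to the mean over the segment with ends `p`, `q`, and
distributes this weight as `k / 4` on each end: the means differ by the factor `(p q) ^ (k / 4)`.
The relation extends to complex ends by analytic continuation in one end after the other, and
`x² ± y²` is the product of the two ends.
-/

section

open MeasureTheory ProbabilityTheory Set
open scoped Real

section BetaMeasure

variable {α β : ℝ}

lemma betaPDFReal_of_mem {s : ℝ} (hs : s ∈ Ioo (0 : ℝ) 1) :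
    betaPDFReal α β s = 1 / beta α β * s ^ (α - 1) * (1 - s) ^ (β - 1) :=
  if_pos hs

lemma betaPDFReal_of_notMem {s : ℝ} (hs : s ∉ Ioo (0 : ℝ) 1) : betaPDFReal α β s = 0 :=
  if_neg hs

lemma betaPDFReal_nonneg (hα : 0 < α) (hβ : 0 < β) (s : ℝ) : 0 ≤ betaPDFReal α β s := by
  by_cases hs : s ∈ Ioo (0 : ℝ) 1
  · exact (betaPDFReal_pos hs.1 hs.2 hα hβ).le
  · exact (betaPDFReal_of_notMem hs).ge

lemma measurable_betaPDF (α β : ℝ) : Measurable (betaPDF α β) :=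
  (measurable_betaPDFReal α β).ennreal_ofReal

lemma betaPDFReal_one_sub (α β s : ℝ) : betaPDFReal α β (1 - s) = betaPDFReal β α s := by
  have hmem : (0 < 1 - s ∧ 1 - s < 1) ↔ 0 < s ∧ s < 1 := by
    rw [sub_pos, sub_lt_self_iff, and_comm]
  have hbeta : beta α β = beta β α := by
    rw [beta, beta, mul_comm, add_comm]
  simp only [betaPDFReal, hmem, hbeta, sub_sub_cancel, mul_right_comm]

lemma beta_add_one_add_one (hα : 0 < α) (hβ : 0 < β) :
    beta (α + 1) (β + 1) = α * β / ((α + β) * (α + β + 1)) * beta α β := by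
  have hαβ : 0 < α + β := add_pos hα hβ
  rw [beta, beta, show α + 1 + (β + 1) = α + β + 1 + 1 by ring, Real.Gamma_add_one hα.ne',
    Real.Gamma_add_one hβ.ne', Real.Gamma_add_one (add_pos hαβ one_pos).ne',
    Real.Gamma_add_one hαβ.ne']
  field_simp

lemma mul_one_sub_mul_betaPDFReal (hα : 0 < α) (hβ : 0 < β) (s : ℝ) :
    s * (1 - s) * betaPDFReal α β s =
      α * β / ((α + β) * (α + β + 1)) * betaPDFReal (α + 1) (β + 1) s := by
  by_cases hs : s ∈ Ioo (0 : ℝ) 1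
  · have hbeta := beta_pos hα hβ
    rw [betaPDFReal_of_mem hs, betaPDFReal_of_mem hs, beta_add_one_add_one hα hβ,
      add_sub_cancel_right, add_sub_cancel_right, Real.rpow_sub_one hs.1.ne',
      Real.rpow_sub_one (sub_pos.2 hs.2).ne']
    have hs0 := hs.1.ne'
    have hs1 := (sub_pos.2 hs.2).ne'
    field_simp
  · simp only [betaPDFReal_of_notMem hs, mul_zero]

lemma ae_betaMeasure_mem_Ioo (α β : ℝ) : ∀ᵐ s ∂betaMeasure α β, s ∈ Ioo (0 : ℝ) 1 := by
  rw [betaMeasure, ae_withDensity_iff (measurable_betaPDF α β)]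
  refine .of_forall fun s hs => ?_
  by_contra hs'
  exact hs (by rw [betaPDF, betaPDFReal_of_notMem hs', ENNReal.ofReal_zero])

lemma ae_betaMeasure_mem_Icc (α β : ℝ) : ∀ᵐ s ∂betaMeasure α β, s ∈ Icc (0 : ℝ) 1 :=
  (ae_betaMeasure_mem_Ioo α β).mono fun _ hs => Ioo_subset_Icc_self hs

variable {E : Type*} [NormedAddCommGroup E] [NormedSpace ℝ E]

lemma integral_betaMeasure (hα : 0 < α) (hβ : 0 < β) (f : ℝ → E) :
    ∫ s, f s ∂betaMeasure α β = ∫ s, betaPDFReal α β s • f s := by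
  rw [betaMeasure, integral_withDensity_eq_integral_toReal_smul
    (measurable_betaPDF α β) (.of_forall fun _ => ENNReal.ofReal_lt_top)]
  simp only [betaPDF, ENNReal.toReal_ofReal (betaPDFReal_nonneg hα hβ _)]

lemma integral_betaMeasure_eq_setIntegral (hα : 0 < α) (hβ : 0 < β) (f : ℝ → E) :
    ∫ s, f s ∂betaMeasure α β = ∫ s in Ioo (0 : ℝ) 1, betaPDFReal α β s • f s := by
  rw [integral_betaMeasure hα hβ, setIntegral_eq_integral_of_forall_compl_eq_zero fun s hs => ?_]
  rw [betaPDFReal_of_notMem hs, zero_smul]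

lemma integral_one_sub_betaMeasure (hα : 0 < α) (hβ : 0 < β) (f : ℝ → E) :
    ∫ s, f (1 - s) ∂betaMeasure α β = ∫ s, f s ∂betaMeasure β α := by
  rw [integral_betaMeasure hα hβ, integral_betaMeasure hβ hα,
    ← integral_sub_left_eq_self (fun s => betaPDFReal β α s • f s) volume 1]
  simp only [betaPDFReal_one_sub]

lemma integral_mul_one_sub_smul_betaMeasure (hα : 0 < α) (hβ : 0 < β) (f : ℝ → E) :
    ∫ s, (s * (1 - s)) • f s ∂betaMeasure α β =
      (α * β / ((α + β) * (α + β + 1))) • ∫ s, f s ∂betaMeasure (α + 1) (β + 1) := by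
  rw [integral_betaMeasure hα hβ, integral_betaMeasure (by positivity) (by positivity),
    ← integral_smul]
  refine integral_congr_ae (.of_forall fun s => ?_)
  simp only [smul_smul, ← mul_one_sub_mul_betaPDFReal hα hβ, mul_comm]

end BetaMeasure

section ProjectiveSubstitution

/-- The projective transformation of `(0, 1)` that fixes both ends of the interval and carries the
mean `s p + (1 - s) q` to the inverse of a mean of `1 / p` and `1 / q`. -/
noncomputable def projectiveShift (p q s : ℝ) : ℝ := s * p / (s * p + (1 - s) * q)

variable {α β p q s : ℝ}

lemma mul_add_one_sub_mul_pos (hp : 0 < p) (hq : 0 < q) (hs : s ∈ Ioo (0 : ℝ) 1) :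
    0 < s * p + (1 - s) * q :=
  add_pos (mul_pos hs.1 hp) (mul_pos (sub_pos.2 hs.2) hq)

lemma one_sub_projectiveShift (hp : 0 < p) (hq : 0 < q) (hs : s ∈ Ioo (0 : ℝ) 1) :
    1 - projectiveShift p q s = (1 - s) * q / (s * p + (1 - s) * q) := by
  rw [projectiveShift, one_sub_div (mul_add_one_sub_mul_pos hp hq hs).ne', add_sub_cancel_left]

lemma projectiveShift_mem_Ioo (hp : 0 < p) (hq : 0 < q) (hs : s ∈ Ioo (0 : ℝ) 1) :
    projectiveShift p q s ∈ Ioo (0 : ℝ) 1 := by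
  have hpos := mul_add_one_sub_mul_pos hp hq hs
  refine ⟨div_pos (mul_pos hs.1 hp) hpos, sub_pos.1 ?_⟩
  rw [one_sub_projectiveShift hp hq hs]
  exact div_pos (mul_pos (sub_pos.2 hs.2) hq) hpos

lemma projectiveShift_projectiveShift (hp : 0 < p) (hq : 0 < q) (hs : s ∈ Ioo (0 : ℝ) 1) :
    projectiveShift q p (projectiveShift p q s) = s := by
  have hpos := mul_add_one_sub_mul_pos hp hq hs
  rw [projectiveShift, one_sub_projectiveShift hp hq hs, projectiveShift]
  field_simp
  ring

lemma invOn_projectiveShift (hp : 0 < p) (hq : 0 < q) :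
    InvOn (projectiveShift q p) (projectiveShift p q) (Ioo 0 1) (Ioo 0 1) :=
  ⟨fun _ hs => projectiveShift_projectiveShift hp hq hs,
    fun _ hs => projectiveShift_projectiveShift hq hp hs⟩

lemma bijOn_projectiveShift (hp : 0 < p) (hq : 0 < q) :
    BijOn (projectiveShift p q) (Ioo 0 1) (Ioo 0 1) :=
  (invOn_projectiveShift hp hq).bijOn (fun _ hs => projectiveShift_mem_Ioo hp hq hs)
    fun _ hs => projectiveShift_mem_Ioo hq hp hs

lemma hasDerivAt_projectiveShift (hs : s * p + (1 - s) * q ≠ 0) :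
    HasDerivAt (projectiveShift p q) (p * q / (s * p + (1 - s) * q) ^ 2) s := by
  have hnum : HasDerivAt (fun s : ℝ => s * p) p s := by
    simpa only [one_mul] using (hasDerivAt_id' s).mul_const p
  have hden : HasDerivAt (fun s : ℝ => s * p + (1 - s) * q) (p + -1 * q) s :=
    hnum.add (((hasDerivAt_id' s).const_sub 1).mul_const q)
  refine (hnum.div hden hs).congr_deriv ?_
  congr 1
  ring

lemma projectiveShift_mul_inv_add (hp : 0 < p) (hq : 0 < q) (hs : s ∈ Ioo (0 : ℝ) 1) :
    projectiveShift p q s * p⁻¹ + (1 - projectiveShift p q s) * q⁻¹ =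
      (s * p + (1 - s) * q)⁻¹ := by
  have hpos := mul_add_one_sub_mul_pos hp hq hs
  rw [one_sub_projectiveShift hp hq hs, projectiveShift]
  field_simp
  ring

lemma deriv_mul_betaPDFReal_projectiveShift (hp : 0 < p) (hq : 0 < q) (hs : s ∈ Ioo (0 : ℝ) 1) :
    p * q / (s * p + (1 - s) * q) ^ 2 * betaPDFReal α β (projectiveShift p q s) =
      p ^ α * q ^ β * (s * p + (1 - s) * q) ^ (-(α + β)) * betaPDFReal α β s := by
  have hpos := mul_add_one_sub_mul_pos hp hq hs
  have hs' := sub_pos.2 hs.2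
  rw [betaPDFReal_of_mem (projectiveShift_mem_Ioo hp hq hs), betaPDFReal_of_mem hs,
    one_sub_projectiveShift hp hq hs, projectiveShift]
  generalize s * p + (1 - s) * q = r at hpos ⊢
  rw [Real.div_rpow (mul_pos hs.1 hp).le hpos.le, Real.div_rpow (mul_pos hs' hq).le hpos.le,
    Real.mul_rpow hs.1.le hp.le, Real.mul_rpow hs'.le hq.le, Real.rpow_sub_one hp.ne',
    Real.rpow_sub_one hq.ne', Real.rpow_sub_one hpos.ne', Real.rpow_sub_one hpos.ne',
    Real.rpow_neg hpos.le, Real.rpow_add hpos]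
  field_simp

lemma integral_betaMeasure_comp_projectiveShift {E : Type*} [NormedAddCommGroup E]
    [NormedSpace ℝ E] (hα : 0 < α) (hβ : 0 < β) (hp : 0 < p) (hq : 0 < q) (f : ℝ → E) :
    ∫ t, f t ∂betaMeasure α β =
      ∫ s, (p ^ α * q ^ β * (s * p + (1 - s) * q) ^ (-(α + β))) • f (projectiveShift p q s)
        ∂betaMeasure α β := by
  rw [integral_betaMeasure_eq_setIntegral hα hβ, integral_betaMeasure_eq_setIntegral hα hβ,
    ← (bijOn_projectiveShift hp hq).image_eq, integral_image_eq_integral_abs_deriv_smul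
      measurableSet_Ioo (fun s hs => (hasDerivAt_projectiveShift
        (mul_add_one_sub_mul_pos hp hq hs).ne').hasDerivWithinAt)
      (bijOn_projectiveShift hp hq).injOn, (bijOn_projectiveShift hp hq).image_eq]
  refine setIntegral_congr_fun measurableSet_Ioo fun s hs => ?_
  simp only [smul_smul]
  rw [abs_of_nonneg (by positivity), deriv_mul_betaPDFReal_projectiveShift hp hq hs, mul_comm]

end ProjectiveSubstitution

/-- The right half-plane, the domain of the theta series in the variable `τ`. -/
def rightHalfPlane : Set ℂ := {τ | 0 < τ.re}

section SegmentMean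

/-- The mean of `h` along the segment from `w'` (parameter `0`) to `w` (parameter `1`), weighted by
a measure `μ` that is meant to be carried by `[0, 1]`. -/
noncomputable def segmentMean (μ : Measure ℝ) (h : ℂ → ℂ) (w w' : ℂ) : ℂ :=
  ∫ s : ℝ, h (s * w + (1 - s) * w') ∂μ

variable {μ : Measure ℝ} {h g : ℂ → ℂ} {w w' : ℂ} {U : Set ℂ}

lemma mul_add_one_sub_mul_mem_segment (w w' : ℂ) {s : ℝ} (hs : s ∈ Icc (0 : ℝ) 1) :
    s * w + (1 - s) * w' ∈ segment ℝ w w' :=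
  ⟨s, 1 - s, hs.1, sub_nonneg.2 hs.2, add_sub_cancel _ _, by simp [Complex.real_smul]⟩

lemma segmentMean_congr (hμ : ∀ᵐ s ∂μ, s ∈ Icc (0 : ℝ) 1) (hhg : EqOn h g (segment ℝ w w')) :
    segmentMean μ h w w' = segmentMean μ g w w' :=
  integral_congr_ae (hμ.mono fun _ hs => hhg (mul_add_one_sub_mul_mem_segment w w' hs))

lemma segmentMean_const_mul (c : ℂ) :
    segmentMean μ (fun τ => c * h τ) w w' = c * segmentMean μ h w w' :=
  integral_const_mul c _

lemma segmentMean_one [IsProbabilityMeasure μ] : segmentMean μ (fun _ => 1) w w' = 1 := by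
  simp only [segmentMean, integral_const, probReal_univ, one_smul]

lemma continuousOn_comp_segment (hh : ContinuousOn h (segment ℝ w w')) :
    ContinuousOn (fun s : ℝ => h (s * w + (1 - s) * w')) (Icc 0 1) :=
  hh.comp (by fun_prop) fun _ hs => mul_add_one_sub_mul_mem_segment w w' hs

lemma isCompact_convexJoin {E : Type*} [AddCommGroup E] [Module ℝ E] [TopologicalSpace E]
    [ContinuousAdd E] [ContinuousSMul ℝ E] {K L : Set E} (hK : IsCompact K) (hL : IsCompact L) :
    IsCompact (convexJoin ℝ K L) := by
  have himage : convexJoin ℝ K L =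
      (fun p : ℝ × E × E => (1 - p.1) • p.2.1 + p.1 • p.2.2) '' Icc 0 1 ×ˢ K ×ˢ L := by
    ext z
    simp only [mem_convexJoin, segment_eq_image, mem_image, Prod.exists, mem_prod]
    grind
  rw [himage]
  exact (isCompact_Icc.prod (hK.prod hL)).image (by fun_prop)

lemma exists_forall_norm_le_of_mem_segment (hU : Convex ℝ U) (hh : ContinuousOn h U) {K : Set ℂ}
    (hK : IsCompact K) (hKU : K ⊆ U) (hw' : w' ∈ U) :
    ∃ C, ∀ w ∈ K, ∀ z ∈ segment ℝ w w', ‖h z‖ ≤ C := by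
  obtain ⟨C, hC⟩ := (isCompact_convexJoin hK isCompact_singleton).exists_bound_of_continuousOn
    (hh.mono (convexJoin_subset hKU (singleton_subset_iff.2 hw') hU))
  exact ⟨C, fun w hw z hz => hC z (mem_convexJoin.2 ⟨w, hw, w', rfl, hz⟩)⟩

variable [IsFiniteMeasure μ]

lemma integrable_of_continuousOn_Icc {E : Type*} [NormedAddCommGroup E]
    (hμ : ∀ᵐ s ∂μ, s ∈ Icc (0 : ℝ) 1) {f : ℝ → E} (hf : ContinuousOn f (Icc 0 1)) :
    Integrable f μ := by
  rw [← Measure.restrict_eq_self_of_ae_mem hμ]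
  exact hf.integrableOn_compact isCompact_Icc

lemma hasSum_segmentMean {ι : Type*} [Countable ι] (hμ : ∀ᵐ s ∂μ, s ∈ Icc (0 : ℝ) 1)
    {f : ι → ℂ → ℂ} {b : ι → ℝ} (hf : ∀ i, ContinuousOn (f i) (segment ℝ w w'))
    (hb : ∀ i, ∀ z ∈ segment ℝ w w', ‖f i z‖ ≤ b i) (hbs : Summable b)
    (hfh : ∀ z ∈ segment ℝ w w', HasSum (fun i => f i z) (h z)) :
    HasSum (fun i => segmentMean μ (f i) w w') (segmentMean μ h w w') := by
  have hmem := hμ.mono fun s hs => mul_add_one_sub_mul_mem_segment w w' hs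
  exact hasSum_integral_of_dominated_convergence (fun i _ => b i)
    (fun i =>
      (integrable_of_continuousOn_Icc hμ (continuousOn_comp_segment (hf i))).aestronglyMeasurable)
    (fun i => hmem.mono fun s hs => hb i _ hs) (.of_forall fun _ => hbs)
    (integrable_const _) (hmem.mono fun s hs => hfh _ hs)

lemma differentiableOn_segmentMean (hμ : ∀ᵐ s ∂μ, s ∈ Icc (0 : ℝ) 1) (hU : IsOpen U)
    (hUc : Convex ℝ U) (hh : DifferentiableOn ℂ h U) (hw' : w' ∈ U) :
    DifferentiableOn ℂ (fun w => segmentMean μ h w w') U := by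
  intro w₀ hw₀
  have hd : ContinuousOn (deriv h) U := (hh.deriv hU).continuousOn
  obtain ⟨δ, hδ, hball⟩ := Metric.nhds_basis_closedBall.mem_iff.1 (hU.mem_nhds hw₀)
  obtain ⟨C, hC⟩ :=
    exists_forall_norm_le_of_mem_segment hUc hd (isCompact_closedBall w₀ δ) hball hw'
  have hint {f : ℂ → ℂ} (hf : ContinuousOn f U) {w : ℂ} (hw : w ∈ U) :
      ContinuousOn (fun s : ℝ => f (s * w + (1 - s) * w')) (Icc 0 1) :=
    continuousOn_comp_segment (hf.mono (hUc.segment_subset hw hw'))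
  refine (hasDerivAt_integral_of_dominated_loc_of_deriv_le (bound := fun _ => C)
    (F' := fun w (s : ℝ) => deriv h (s * w + (1 - s) * w') * s)
    (Metric.closedBall_mem_nhds w₀ hδ) ?_ ?_ ?_ ?_ (integrable_const C)
    ?_).2.differentiableAt.differentiableWithinAt
  · filter_upwards [hU.mem_nhds hw₀] with w hw
    exact (integrable_of_continuousOn_Icc hμ (hint hh.continuousOn hw)).aestronglyMeasurable
  · exact integrable_of_continuousOn_Icc hμ (hint hh.continuousOn hw₀)
  · exact (integrable_of_continuousOn_Icc hμ
      ((hint hd hw₀).mul (by fun_prop))).aestronglyMeasurable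
  · filter_upwards [hμ] with s hs w hw
    have hbound := hC w hw _ (mul_add_one_sub_mul_mem_segment w w' hs)
    rw [norm_mul, Complex.norm_real, Real.norm_of_nonneg hs.1]
    exact (mul_le_of_le_one_right (norm_nonneg _) hs.2).trans hbound
  · filter_upwards [hμ] with s hs w hw
    have hmem := hUc.segment_subset (hball hw) hw' (mul_add_one_sub_mul_mem_segment w w' hs)
    have hinner : HasDerivAt (fun w : ℂ => (s : ℂ) * w + (1 - s) * w') (s : ℂ) w := by
      simpa only [mul_one, id] using
        ((hasDerivAt_id w).const_mul (s : ℂ)).add_const ((1 - s) * w')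
    exact (hh.differentiableAt (hU.mem_nhds hmem)).hasDerivAt.comp w hinner

lemma hasSum_segmentMean_exp {ι : Type*} [Countable ι] (hμ : ∀ᵐ s ∂μ, s ∈ Icc (0 : ℝ) 1)
    {c : ι → ℂ} {freq : ι → ℝ} (hfreq : ∀ i, 0 ≤ freq i)
    (hh : ∀ τ ∈ rightHalfPlane, HasSum (fun i => c i * Complex.exp (-(freq i * τ))) (h τ))
    (hw : w ∈ rightHalfPlane) (hw' : w' ∈ rightHalfPlane) :
    HasSum (fun i => c i * segmentMean μ (fun τ => Complex.exp (-(freq i * τ))) w w')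
      (segmentMean μ h w w') := by
  have hre : segment ℝ w w' ⊆ {z : ℂ | min w.re w'.re ≤ z.re} :=
    (convex_halfSpace_re_ge _).segment_subset (min_le_left w.re w'.re) (min_le_right w.re w'.re)
  have hmin : 0 < min w.re w'.re := lt_min hw hw'
  simp only [← segmentMean_const_mul]
  refine hasSum_segmentMean hμ
    (b := fun i => ‖c i * Complex.exp (-(freq i * (min w.re w'.re : ℝ)))‖)
    (fun i => by fun_prop) (fun i z hz => ?_) (hh _ (show 0 < (_ : ℂ).re from hmin)).summable.norm
    fun z hz => hh z (hmin.trans_le (hre hz))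
  rw [norm_mul, norm_mul, Complex.norm_exp, Complex.norm_exp]
  simp only [Complex.neg_re, Complex.re_ofReal_mul, Complex.ofReal_re]
  gcongr
  · exact hfreq i
  · exact hre hz

end SegmentMean

section RightHalfPlane

lemma isOpen_rightHalfPlane : IsOpen rightHalfPlane :=
  isOpen_lt continuous_const Complex.continuous_re

lemma convex_rightHalfPlane : Convex ℝ rightHalfPlane :=
  convex_halfSpace_re_gt 0

lemma mem_rightHalfPlane {τ : ℂ} : τ ∈ rightHalfPlane ↔ 0 < τ.re := Iff.rfl

lemma rightHalfPlane_subset_slitPlane : rightHalfPlane ⊆ Complex.slitPlane :=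
  fun _ hτ => Or.inl hτ

lemma ne_zero_of_mem_rightHalfPlane {τ : ℂ} (hτ : τ ∈ rightHalfPlane) : τ ≠ 0 :=
  Complex.slitPlane_ne_zero (rightHalfPlane_subset_slitPlane hτ)

lemma inv_mem_rightHalfPlane {τ : ℂ} (hτ : τ ∈ rightHalfPlane) : τ⁻¹ ∈ rightHalfPlane := by
  rw [mem_rightHalfPlane, Complex.inv_re]
  exact div_pos hτ (Complex.normSq_pos.2 (ne_zero_of_mem_rightHalfPlane hτ))

lemma differentiableOn_cpow_rightHalfPlane (c : ℂ) :
    DifferentiableOn ℂ (fun τ : ℂ => τ ^ c) rightHalfPlane :=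
  differentiableOn_id.cpow_const fun _ hτ => rightHalfPlane_subset_slitPlane hτ

lemma differentiableOn_comp_inv {h : ℂ → ℂ} (hh : DifferentiableOn ℂ h rightHalfPlane) :
    DifferentiableOn ℂ (fun τ => h τ⁻¹) rightHalfPlane :=
  hh.comp (differentiableOn_inv.mono fun _ hτ => ne_zero_of_mem_rightHalfPlane hτ)
    fun _ hτ => inv_mem_rightHalfPlane hτ

lemma mul_cpow_of_mem_rightHalfPlane {w w' : ℂ} (hw : w ∈ rightHalfPlane)
    (hw' : w' ∈ rightHalfPlane) (c : ℂ) : (w * w') ^ c = w ^ c * w' ^ c := by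
  have harg := abs_lt.1 (Complex.abs_arg_lt_pi_div_two_iff.2 (.inl hw))
  have harg' := abs_lt.1 (Complex.abs_arg_lt_pi_div_two_iff.2 (.inl hw'))
  have hlog : Complex.log (w * w') = Complex.log w + Complex.log w' :=
    Complex.log_mul (ne_zero_of_mem_rightHalfPlane hw) (ne_zero_of_mem_rightHalfPlane hw')
      ⟨by linarith, by linarith⟩
  rw [Complex.cpow_def_of_ne_zero (ne_zero_of_mem_rightHalfPlane hw),
    Complex.cpow_def_of_ne_zero (ne_zero_of_mem_rightHalfPlane hw'), ← Complex.exp_add, ← add_mul,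
    ← hlog, Complex.cpow_def_of_ne_zero (mul_ne_zero (ne_zero_of_mem_rightHalfPlane hw)
      (ne_zero_of_mem_rightHalfPlane hw'))]

lemma eqOn_rightHalfPlane_of_eq_ofReal {f g : ℂ → ℂ} (hf : DifferentiableOn ℂ f rightHalfPlane)
    (hg : DifferentiableOn ℂ g rightHalfPlane) (hfg : ∀ p : ℝ, 0 < p → f p = g p) :
    EqOn f g rightHalfPlane := by
  refine (hf.analyticOnNhd isOpen_rightHalfPlane).eqOn_of_preconnected_of_frequently_eq
    (hg.analyticOnNhd isOpen_rightHalfPlane) convex_rightHalfPlane.isPreconnected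
    (z₀ := ((1 : ℝ) : ℂ)) (mem_rightHalfPlane.2 one_pos) ?_
  have hofReal : Filter.Tendsto ((↑) : ℝ → ℂ) (nhdsWithin 1 {1}ᶜ) (nhdsWithin (1 : ℝ) {1}ᶜ) :=
    Complex.continuous_ofReal.continuousWithinAt.tendsto_nhdsWithin
      fun _ hp => Complex.ofReal_injective.ne hp
  refine hofReal.frequently (Filter.Eventually.frequently ?_)
  filter_upwards [nhdsWithin_le_nhds (lt_mem_nhds one_pos)] with p hp using hfg p hp

lemma eq_of_forall_ofReal_eq {F G : ℂ → ℂ → ℂ}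
    (hF : ∀ w' ∈ rightHalfPlane, DifferentiableOn ℂ (fun w => F w w') rightHalfPlane)
    (hF' : ∀ w ∈ rightHalfPlane, DifferentiableOn ℂ (F w) rightHalfPlane)
    (hG : ∀ w' ∈ rightHalfPlane, DifferentiableOn ℂ (fun w => G w w') rightHalfPlane)
    (hG' : ∀ w ∈ rightHalfPlane, DifferentiableOn ℂ (G w) rightHalfPlane)
    (hFG : ∀ p q : ℝ, 0 < p → 0 < q → F p q = G p q) {w w' : ℂ} (hw : w ∈ rightHalfPlane)
    (hw' : w' ∈ rightHalfPlane) : F w w' = G w w' := by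
  refine eqOn_rightHalfPlane_of_eq_ofReal (hF' w hw) (hG' w hw) (fun q hq => ?_) hw'
  exact eqOn_rightHalfPlane_of_eq_ofReal (hF q hq) (hG q hq) (fun p hp => hFG p q hp hq) hw

end RightHalfPlane

section BetaSegmentMean

variable {α β : ℝ} {h : ℂ → ℂ} {w w' : ℂ}

lemma segmentMean_betaMeasure_swap (hα : 0 < α) (hβ : 0 < β) (h : ℂ → ℂ) (w w' : ℂ) :
    segmentMean (betaMeasure α β) h w w' = segmentMean (betaMeasure β α) h w' w := by
  rw [segmentMean, segmentMean, ← integral_one_sub_betaMeasure hα hβ]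
  simp only [Complex.ofReal_sub, Complex.ofReal_one, sub_sub_cancel, add_comm]

lemma differentiableOn_segmentMean_betaMeasure_left (hα : 0 < α) (hβ : 0 < β)
    (hh : DifferentiableOn ℂ h rightHalfPlane) (hw' : w' ∈ rightHalfPlane) :
    DifferentiableOn ℂ (fun w => segmentMean (betaMeasure α β) h w w') rightHalfPlane :=
  have := isProbabilityMeasureBeta hα hβ
  differentiableOn_segmentMean (ae_betaMeasure_mem_Icc α β) isOpen_rightHalfPlane
    convex_rightHalfPlane hh hw'

lemma differentiableOn_segmentMean_betaMeasure_right (hα : 0 < α) (hβ : 0 < β)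
    (hh : DifferentiableOn ℂ h rightHalfPlane) (hw : w ∈ rightHalfPlane) :
    DifferentiableOn ℂ (segmentMean (betaMeasure α β) h w) rightHalfPlane := by
  simpa only [← segmentMean_betaMeasure_swap hα hβ] using
    differentiableOn_segmentMean_betaMeasure_left hβ hα hh hw

lemma segmentMean_betaMeasure_ofReal_inv (hα : 0 < α) (hβ : 0 < β) (h : ℂ → ℂ) {p q : ℝ}
    (hp : 0 < p) (hq : 0 < q) :
    segmentMean (betaMeasure α β) h (p : ℂ)⁻¹ (q : ℂ)⁻¹ = (p : ℂ) ^ (α : ℂ) * (q : ℂ) ^ (β : ℂ) *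
      segmentMean (betaMeasure α β) (fun τ => τ ^ (-(α + β : ℂ)) * h τ⁻¹) p q := by
  rw [segmentMean, integral_betaMeasure_comp_projectiveShift hα hβ hp hq,
    ← segmentMean_const_mul, segmentMean]
  refine integral_congr_ae ((ae_betaMeasure_mem_Ioo α β).mono fun s hs => ?_)
  have hpos := mul_add_one_sub_mul_pos hp hq hs
  have hpoint : projectiveShift p q s * (p : ℂ)⁻¹ + (1 - projectiveShift p q s) * (q : ℂ)⁻¹ =
      (s * p + (1 - s) * q : ℂ)⁻¹ := by
    exact_mod_cast congrArg ((↑) : ℝ → ℂ) (projectiveShift_mul_inv_add hp hq hs)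
  simp only [hpoint, Complex.real_smul, Complex.ofReal_mul, Complex.ofReal_cpow hp.le,
    Complex.ofReal_cpow hq.le, Complex.ofReal_cpow hpos.le]
  push_cast
  ring

lemma segmentMean_betaMeasure_inv (hα : 0 < α) (hβ : 0 < β)
    (hh : DifferentiableOn ℂ h rightHalfPlane) (hw : w ∈ rightHalfPlane)
    (hw' : w' ∈ rightHalfPlane) :
    segmentMean (betaMeasure α β) h w⁻¹ w'⁻¹ = w ^ (α : ℂ) * w' ^ (β : ℂ) *
      segmentMean (betaMeasure α β) (fun τ => τ ^ (-(α + β : ℂ)) * h τ⁻¹) w w' := by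
  have hmod : DifferentiableOn ℂ (fun τ => τ ^ (-(α + β : ℂ)) * h τ⁻¹) rightHalfPlane :=
    (differentiableOn_cpow_rightHalfPlane _).mul (differentiableOn_comp_inv hh)
  refine eq_of_forall_ofReal_eq
    (F := fun w w' => segmentMean (betaMeasure α β) h w⁻¹ w'⁻¹)
    (G := fun w w' => w ^ (α : ℂ) * w' ^ (β : ℂ) *
      segmentMean (betaMeasure α β) (fun τ => τ ^ (-(α + β : ℂ)) * h τ⁻¹) w w')
    (fun w' hw' => ?_) (fun w hw => ?_) (fun w' hw' => ?_) (fun w hw => ?_)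
    (fun p q hp hq => segmentMean_betaMeasure_ofReal_inv hα hβ h hp hq) hw hw'
  · exact differentiableOn_comp_inv (differentiableOn_segmentMean_betaMeasure_left hα hβ hh
      (inv_mem_rightHalfPlane hw'))
  · exact differentiableOn_comp_inv (differentiableOn_segmentMean_betaMeasure_right hα hβ hh
      (inv_mem_rightHalfPlane hw))
  · exact ((differentiableOn_cpow_rightHalfPlane _).mul_const _).mul
      (differentiableOn_segmentMean_betaMeasure_left hα hβ hmod hw')
  · exact ((differentiableOn_cpow_rightHalfPlane _).const_mul _).mul
      (differentiableOn_segmentMean_betaMeasure_right hα hβ hmod hw)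

end BetaSegmentMean

section PoissonIntegral

/-- The entire factor of the modified Bessel function:
`I_ν z = (z / 2) ^ ν * besselSeries ν z`, whatever the determination of the power. -/
noncomputable def besselSeries (ν z : ℂ) : ℂ :=
  ∑' m : ℕ, (z / 2) ^ (2 * m) / ((m.factorial : ℂ) * Complex.Gamma (ν + m + 1))

variable {a : ℝ}

lemma integrable_pow_two_mul_sub_one_betaMeasure (ha : 0 < a) (m : ℕ) :
    Integrable (fun s : ℝ => (2 * s - 1) ^ m) (betaMeasure a a) := by
  have := isProbabilityMeasureBeta ha ha
  exact integrable_of_continuousOn_Icc (ae_betaMeasure_mem_Icc a a) (by fun_prop)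

lemma integral_two_mul_sub_one_pow_succ_betaMeasure (ha : 0 < a) (m : ℕ) :
    ∫ s, (2 * s - 1) ^ (2 * (m + 1)) ∂betaMeasure a a =
      ∫ s, (2 * s - 1) ^ (2 * m) ∂betaMeasure a a -
        2 * a / (2 * a + 1) * ∫ s, (2 * s - 1) ^ (2 * m) ∂betaMeasure (a + 1) (a + 1) := by
  have hexpand (s : ℝ) : (2 * s - 1) ^ (2 * (m + 1)) =
      (2 * s - 1) ^ (2 * m) - 4 * ((s * (1 - s)) • (2 * s - 1) ^ (2 * m)) := by
    rw [smul_eq_mul]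
    ring
  have hint : Integrable (fun s : ℝ => 4 * ((s * (1 - s)) • (2 * s - 1) ^ (2 * m)))
      (betaMeasure a a) := by
    refine ((integrable_pow_two_mul_sub_one_betaMeasure ha (2 * m)).sub
      (integrable_pow_two_mul_sub_one_betaMeasure ha (2 * (m + 1)))).congr (.of_forall fun s => ?_)
    simp only [Pi.sub_apply, hexpand, sub_sub_cancel]
  simp only [hexpand]
  rw [integral_sub (integrable_pow_two_mul_sub_one_betaMeasure ha _) hint, integral_const_mul,
    integral_mul_one_sub_smul_betaMeasure ha ha, smul_eq_mul, ← mul_assoc]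
  congr 2
  field_simp
  ring

lemma integral_two_mul_sub_one_pow_betaMeasure (ha : 0 < a) (m : ℕ) :
    ∫ s, (2 * s - 1) ^ (2 * m) ∂betaMeasure a a =
      (2 * m).factorial / (4 ^ m * m.factorial) *
        (Real.Gamma (a + 1 / 2) / Real.Gamma (a + 1 / 2 + m)) := by
  induction m generalizing a with
  | zero =>
    have := isProbabilityMeasureBeta ha ha
    have hGamma : Real.Gamma (a + 1 / 2) ≠ 0 := (Real.Gamma_pos_of_pos (by positivity)).ne'
    rw [Nat.cast_zero, add_zero, div_self hGamma]
    simp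
  | succ m ih =>
    rw [integral_two_mul_sub_one_pow_succ_betaMeasure ha, ih ha, ih (by positivity),
      show a + 1 + 1 / 2 = a + 1 / 2 + 1 by ring, Real.Gamma_add_one (by positivity),
      show a + 1 / 2 + 1 + m = a + 1 / 2 + m + 1 by ring,
      show a + 1 / 2 + (m + 1 : ℕ) = a + 1 / 2 + m + 1 by push_cast; ring,
      Real.Gamma_add_one (by positivity), show 2 * (m + 1) = 2 * m + 1 + 1 by ring,
      Nat.factorial_succ, Nat.factorial_succ, Nat.factorial_succ]
    push_cast
    field_simp
    ring

lemma segmentMean_pow_betaMeasure (ha : 0 < a) (m : ℕ) (z : ℂ) :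
    segmentMean (betaMeasure a a) (fun τ => τ ^ (2 * m) / (2 * m).factorial) z (-z) =
      Complex.Gamma (a + 1 / 2) *
        ((z / 2) ^ (2 * m) / ((m.factorial : ℂ) * Complex.Gamma (a - 1 / 2 + m + 1))) := by
  have hpoint (s : ℝ) : (s * z + (1 - s) * -z) ^ (2 * m) / ((2 * m).factorial : ℂ) =
      z ^ (2 * m) / (2 * m).factorial * ((2 * s - 1) ^ (2 * m) : ℝ) := by
    push_cast
    rw [show s * z + (1 - s) * -z = z * (2 * s - 1) by ring, mul_pow]
    ring
  simp only [segmentMean, hpoint]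
  rw [integral_const_mul, integral_complex_ofReal, integral_two_mul_sub_one_pow_betaMeasure ha,
    show (a - 1 / 2 + m + 1 : ℂ) = ((a + 1 / 2 + m : ℝ) : ℂ) by push_cast; ring,
    show (a + 1 / 2 : ℂ) = ((a + 1 / 2 : ℝ) : ℂ) by push_cast; ring, Complex.Gamma_ofReal,
    Complex.Gamma_ofReal, div_pow, pow_mul 2]
  push_cast
  have hfact : ((2 * m).factorial : ℂ) ≠ 0 := Nat.cast_ne_zero.2 (Nat.factorial_ne_zero _)
  norm_num
  field_simp

lemma segmentMean_cosh_betaMeasure (ha : 0 < a) (z : ℂ) :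
    segmentMean (betaMeasure a a) Complex.cosh z (-z) =
      Complex.Gamma (a + 1 / 2) * besselSeries (a - 1 / 2) z := by
  have := isProbabilityMeasureBeta ha ha
  have hnorm : segment ℝ z (-z) ⊆ Metric.closedBall 0 ‖z‖ :=
    (convex_closedBall 0 ‖z‖).segment_subset (by simp) (by simp)
  have hsum : HasSum _ (segmentMean (betaMeasure a a) Complex.cosh z (-z)) :=
    hasSum_segmentMean (ae_betaMeasure_mem_Icc a a)
      (f := fun (m : ℕ) τ => τ ^ (2 * m) / (2 * m).factorial)
      (b := fun m => ‖z‖ ^ (2 * m) / (2 * m).factorial) (fun m => by fun_prop)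
      (fun m τ hτ => ?_) (Real.hasSum_cosh ‖z‖).summable fun τ _ => Complex.hasSum_cosh τ
  · simp only [segmentMean_pow_betaMeasure ha] at hsum
    rw [← hsum.tsum_eq, tsum_mul_left, besselSeries]
  · rw [norm_div, norm_pow, Complex.norm_natCast]
    gcongr
    exact mem_closedBall_zero_iff.1 (hnorm hτ)

lemma segmentMean_exp_betaMeasure (ha : 0 < a) (z : ℂ) :
    segmentMean (betaMeasure a a) Complex.exp z (-z) =
      Complex.Gamma (a + 1 / 2) * besselSeries (a - 1 / 2) z := by
  have := isProbabilityMeasureBeta ha ha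
  have hint (w w' : ℂ) :
      Integrable (fun s : ℝ => Complex.exp (s * w + (1 - s) * w')) (betaMeasure a a) :=
    integrable_of_continuousOn_Icc (ae_betaMeasure_mem_Icc a a)
      (continuousOn_comp_segment (by fun_prop))
  have hcosh (s : ℝ) : Complex.cosh (s * z + (1 - s) * -z) =
      (Complex.exp (s * z + (1 - s) * -z) + Complex.exp (s * -z + (1 - s) * z)) / 2 := by
    rw [Complex.cosh, show -(s * z + (1 - s) * -z) = s * -z + (1 - s) * z by ring]
  have hmean : segmentMean (betaMeasure a a) Complex.cosh z (-z) =
      (segmentMean (betaMeasure a a) Complex.exp z (-z) +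
        segmentMean (betaMeasure a a) Complex.exp (-z) z) / 2 := by
    simp only [segmentMean, hcosh]
    rw [integral_div, integral_add (hint _ _) (hint _ _)]
  rw [← segmentMean_cosh_betaMeasure ha, hmean, segmentMean_betaMeasure_swap ha ha _ (-z),
    add_self_div_two]

lemma segmentMean_exp_neg_mul_betaMeasure (ha : 0 < a) (c x v : ℂ) :
    segmentMean (betaMeasure a a) (fun τ => Complex.exp (-(c * τ))) (x + v) (x - v) =
      Complex.exp (-(c * x)) *
        (Complex.Gamma (a + 1 / 2) * besselSeries (a - 1 / 2) (c * v)) := by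
  rw [← segmentMean_exp_betaMeasure ha, segmentMean_betaMeasure_swap ha ha,
    ← segmentMean_const_mul, segmentMean, segmentMean]
  simp only [← Complex.exp_add]
  congr! 3
  ring

end PoissonIntegral

section SumsOfSquares

lemma hasSum_prod_fin {R ι : Type*} [NormedCommRing R] [CompleteSpace R] {k : ℕ}
    {f : Fin k → ι → R} (hf : ∀ i, Summable fun j => ‖f i j‖) :
    (Summable fun v : Fin k → ι => ‖∏ i, f i (v i)‖) ∧
      HasSum (fun v : Fin k → ι => ∏ i, f i (v i)) (∏ i, ∑' j, f i j) := by
  induction k with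
  | zero => exact ⟨(hasSum_fintype _).summable, by simp⟩
  | succ k ih =>
    obtain ⟨hnorm, hsum⟩ := ih fun i => hf i.succ
    have hcons (p : ι × (Fin k → ι)) :
        ∏ i, f i (Fin.consEquiv (fun _ => ι) p i) = f 0 p.1 * ∏ i, f (Fin.succ i) (p.2 i) := by
      simp [Fin.prod_univ_succ, Fin.consEquiv]
    constructor
    · rw [← (Fin.consEquiv fun _ => ι).summable_iff]
      simpa only [Function.comp_def, hcons] using (hf 0).mul_norm hnorm
    · rw [← (Fin.consEquiv fun _ => ι).hasSum_iff]
      simp only [Function.comp_def, hcons]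
      rw [Fin.prod_univ_succ, ← hsum.tsum_eq, tsum_mul_tsum_of_summable_norm (hf 0) hnorm]
      exact (summable_mul_of_summable_norm (hf 0) hnorm).hasSum

/-- The theta series `∑ exp (-π m² τ)` over `m : ℤ`, on the right half-plane. -/
noncomputable def sqTheta (τ : ℂ) : ℂ := jacobiTheta (Complex.I * τ)

variable {τ : ℂ}

lemma sqTheta_eq_tsum (τ : ℂ) : sqTheta τ = ∑' m : ℤ, Complex.exp (-(π * (m : ℂ) ^ 2 * τ)) := by
  refine tsum_congr fun m => congrArg Complex.exp ?_
  linear_combination (π * (m : ℂ) ^ 2 * τ) * Complex.I_mul_I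

lemma I_mul_im_pos (hτ : τ ∈ rightHalfPlane) : 0 < (Complex.I * τ).im := by
  rwa [Complex.I_mul_im]

lemma summable_exp_neg_pi_mul_sq (hτ : τ ∈ rightHalfPlane) :
    Summable fun m : ℤ => Complex.exp (-(π * (m : ℂ) ^ 2 * τ)) := by
  refine (hasSum_jacobiTheta₂_term 0 (I_mul_im_pos hτ)).summable.congr fun m =>
    congrArg Complex.exp ?_
  linear_combination (π * (m : ℂ) ^ 2 * τ) * Complex.I_mul_I

lemma differentiableOn_sqTheta : DifferentiableOn ℂ sqTheta rightHalfPlane := fun τ hτ =>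
  ((differentiableAt_jacobiTheta (I_mul_im_pos hτ)).comp τ
    (differentiableAt_id.const_mul Complex.I)).differentiableWithinAt

lemma sqTheta_inv (hτ : τ ∈ rightHalfPlane) : sqTheta τ⁻¹ = τ ^ (1 / 2 : ℂ) * sqTheta τ := by
  have hneg (m : ℤ) :
      Complex.exp (-(π * (m : ℂ) ^ 2 * τ)) = Complex.exp (-π * τ * (m : ℂ) ^ 2) := by
    ring_nf
  have hneg_inv (m : ℤ) :
      Complex.exp (-(π * (m : ℂ) ^ 2 * τ⁻¹)) = Complex.exp (-π / τ * (m : ℂ) ^ 2) := by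
    ring_nf
  have hne : τ ^ (1 / 2 : ℂ) ≠ 0 := by
    simp [Complex.cpow_eq_zero_iff, ne_zero_of_mem_rightHalfPlane hτ]
  simp only [sqTheta_eq_tsum, hneg, hneg_inv]
  rw [Complex.tsum_exp_neg_mul_int_sq hτ, one_div (τ ^ _), mul_inv_cancel_left₀ hne]

lemma sqTheta_inv_pow (k : ℕ) (hτ : τ ∈ rightHalfPlane) :
    sqTheta τ⁻¹ ^ k = τ ^ (k / 2 : ℂ) * sqTheta τ ^ k := by
  rw [sqTheta_inv hτ, mul_pow, ← Complex.cpow_nat_mul, mul_one_div]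

lemma sumSqReps_zero (k : ℕ) : sumSqReps k 0 = 1 := by
  have hset : {v : Fin k → ℤ | ∑ i, v i ^ 2 = ((0 : ℕ) : ℤ)} = {0} := by
    ext v
    simp [Finset.sum_eq_zero_iff_of_nonneg fun _ _ => sq_nonneg _, funext_iff]
  rw [sumSqReps, hset, ncard_singleton]

lemma hasSum_sumSqReps_mul {f : ℕ → ℂ} {a : ℂ} {k : ℕ}
    (hf : HasSum (fun v : Fin k → ℤ => f (∑ i, v i ^ 2).toNat) a) :
    HasSum (fun n => (sumSqReps k n : ℂ) * f n) a := by
  refine (hf.tsum_fiberwise fun v => (∑ i, v i ^ 2).toNat).congr_fun fun n => ?_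
  have hfiber : (fun v : Fin k → ℤ => (∑ i, v i ^ 2).toNat) ⁻¹' {n} =
      {v | ∑ i, v i ^ 2 = (n : ℤ)} := by
    ext v
    have hnonneg : 0 ≤ ∑ i, v i ^ 2 := Finset.sum_nonneg fun _ _ => sq_nonneg _
    simp only [mem_preimage, mem_singleton_iff, mem_ofPred_eq]
    omega
  rw [tsum_congr fun v : (_ ⁻¹' {n} : Set (Fin k → ℤ)) => congrArg f v.2, tsum_const, hfiber,
    Nat.card_coe_set_eq, nsmul_eq_mul, sumSqReps]

lemma hasSum_sqTheta_pow (k : ℕ) (hτ : τ ∈ rightHalfPlane) :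
    HasSum (fun n : ℕ => (sumSqReps k n : ℂ) * Complex.exp (-((π * n : ℝ) * τ)))
      (sqTheta τ ^ k) := by
  refine hasSum_sumSqReps_mul ?_
  have hprod := (hasSum_prod_fin fun _ : Fin k => (summable_exp_neg_pi_mul_sq hτ).norm).2
  rw [Fin.prod_const, ← sqTheta_eq_tsum] at hprod
  refine hprod.congr_fun fun v => ?_
  have hcast : (((∑ i, v i ^ 2).toNat : ℕ) : ℂ) = ∑ i, (v i : ℂ) ^ 2 := by
    have := Int.toNat_of_nonneg (Finset.sum_nonneg fun i (_ : i ∈ Finset.univ) => sq_nonneg (v i))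
    exact_mod_cast congrArg (Int.cast (R := ℂ)) this
  rw [← Complex.exp_sum, Finset.sum_neg_distrib, ← Finset.sum_mul, ← Finset.mul_sum, ← hcast,
    Complex.ofReal_mul, Complex.ofReal_natCast]

end SumsOfSquares

section DeterminationOfArgument

lemma powAt_ofReal_mul {r : ℝ} (hr : 0 ≤ r) (z : ℂ) (θ : ℝ) (ν : ℂ) :
    powAt (r * z) θ ν = (r : ℂ) ^ ν * powAt z θ ν := by
  rw [powAt, powAt, norm_mul, Complex.norm_real, Real.norm_of_nonneg hr, Complex.ofReal_mul,
    Complex.mul_cpow_ofReal_nonneg hr (norm_nonneg z), mul_assoc]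

lemma powAt_mul (z w : ℂ) (θ φ : ℝ) (ν : ℂ) :
    powAt (z * w) (θ + φ) ν = powAt z θ ν * powAt w φ ν := by
  rw [powAt, powAt, powAt, norm_mul, Complex.ofReal_mul,
    Complex.mul_cpow_ofReal_nonneg (norm_nonneg z) (norm_nonneg w), Complex.ofReal_add, add_mul,
    mul_add, Complex.exp_add, mul_mul_mul_comm]

lemma powAt_div (y : ℂ) {D : ℂ} (hD : D ≠ 0) (θ : ℝ) (ν : ℂ) :
    powAt (y / D) (θ - D.arg) ν = powAt y θ ν / D ^ ν := by
  have hne : D ^ ν ≠ 0 := by simp [Complex.cpow_eq_zero_iff, hD]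
  rw [eq_div_iff hne, ← powAt_arg, ← powAt_mul, div_mul_cancel₀ y hD, sub_add_cancel]

lemma thetaConst_eq (k : ℕ) (y : ℂ) (θ : ℝ) :
    thetaConst k y θ =
      powAt (π * y / 2) θ (k / 4 - 1 / 2) / Complex.Gamma (k / 4 + 1 / 2) := by
  have htwo : (2 : ℂ) ^ (k / 4 - 1 / 2 : ℂ) ≠ 0 := by simp [Complex.cpow_eq_zero_iff]
  rw [thetaConst, ← mul_div_cancel₀ (π * y : ℂ) two_ne_zero, ← Complex.ofReal_ofNat,
    powAt_ofReal_mul zero_le_two, Complex.ofReal_ofNat, mul_div_mul_left _ _ htwo,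
    mul_div_cancel₀ _ two_ne_zero]

lemma thetaConst_div (k : ℕ) (y : ℂ) {D : ℂ} (hD : D ≠ 0) (θ : ℝ) :
    thetaConst k (y / D) (θ - D.arg) = thetaConst k y θ / D ^ (k / 4 - 1 / 2 : ℂ) := by
  rw [thetaConst, thetaConst, ← mul_div_assoc, powAt_div _ hD, div_right_comm]

end DeterminationOfArgument

section ThetaPowMean

/-- The symmetric Beta mean, of parameter `k / 4`, of the `k`-th power of the theta series along
the segment from `w'` to `w`. -/
noncomputable def thetaPowMean (k : ℕ) (w w' : ℂ) : ℂ :=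
  segmentMean (betaMeasure (k / 4) (k / 4)) (fun τ => sqTheta τ ^ k) w w'

variable {k : ℕ} {w w' : ℂ}

lemma thetaPowMean_swap (hk : 1 ≤ k) (w w' : ℂ) : thetaPowMean k w w' = thetaPowMean k w' w :=
  segmentMean_betaMeasure_swap (by positivity) (by positivity) _ w w'

lemma thetaPowMean_inv (hk : 1 ≤ k) (hw : w ∈ rightHalfPlane) (hw' : w' ∈ rightHalfPlane) :
    thetaPowMean k w⁻¹ w'⁻¹ = (w * w') ^ (k / 4 : ℂ) * thetaPowMean k w w' := by
  have hmod : EqOn (fun τ => τ ^ (-(((k / 4 : ℝ) : ℂ) + (k / 4 : ℝ))) * sqTheta τ⁻¹ ^ k)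
      (fun τ => sqTheta τ ^ k) (segment ℝ w w') := fun τ hτ => by
    have hτ' := convex_rightHalfPlane.segment_subset hw hw' hτ
    simp only
    rw [sqTheta_inv_pow k hτ', ← mul_assoc,
      ← Complex.cpow_add _ _ (ne_zero_of_mem_rightHalfPlane hτ'),
      show -(((k / 4 : ℝ) : ℂ) + (k / 4 : ℝ)) + k / 2 = 0 by push_cast; ring, Complex.cpow_zero,
      one_mul]
  rw [thetaPowMean, segmentMean_betaMeasure_inv (by positivity) (by positivity)
    (differentiableOn_sqTheta.fun_pow k) hw hw',
    segmentMean_congr (ae_betaMeasure_mem_Icc _ _) hmod, ← mul_cpow_of_mem_rightHalfPlane hw hw',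
    thetaPowMean, Complex.ofReal_div, Complex.ofReal_natCast, Complex.ofReal_ofNat]

lemma hasSum_thetaPowMean (hk : 1 ≤ k) (hw : w ∈ rightHalfPlane) (hw' : w' ∈ rightHalfPlane) :
    HasSum (fun n : ℕ+ => (sumSqReps k n : ℂ) * segmentMean (betaMeasure (k / 4) (k / 4))
      (fun τ => Complex.exp (-((π * (n : ℕ) : ℝ) * τ))) w w') (thetaPowMean k w w' - 1) := by
  have hpos : (0 : ℝ) < k / 4 := by positivity
  have := isProbabilityMeasureBeta hpos hpos
  refine (hasSum_pnat_iff (f := fun n : ℕ => (sumSqReps k n : ℂ) *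
    segmentMean _ (fun τ => Complex.exp (-((π * n : ℝ) * τ))) w w')).2 ?_
  simpa [thetaPowMean, sumSqReps_zero, segmentMean_one] using
    hasSum_segmentMean_exp (ae_betaMeasure_mem_Icc _ _) (fun n => by positivity)
      (fun τ hτ => hasSum_sqTheta_pow k hτ) hw hw'

end ThetaPowMean

section BesselSeries

/-- Common form of `thetaITerm` (for `e = 1`) and `thetaJTerm` (for `e = Complex.I`): the two
Bessel functions have the same entire factor up to the rotation of the variable by `e`. -/
noncomputable def thetaBesselTerm (k : ℕ) (e X Y : ℂ) (θ : ℝ) (n : ℕ+) : ℂ :=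
  (sumSqReps k n : ℂ) / ((n : ℕ) : ℂ) ^ (k / 4 - 1 / 2 : ℂ) * Complex.exp (-(π * (n : ℕ) * X)) *
    (powAt (π * (n : ℕ) * Y / 2) θ (k / 4 - 1 / 2) *
      besselSeries (k / 4 - 1 / 2) (e * (π * (n : ℕ) * Y)))

lemma thetaBesselTerm_one (k : ℕ) : thetaBesselTerm k 1 = thetaITerm k := by
  funext X Y θ n
  simp only [thetaBesselTerm, thetaITerm, besselIAt, besselSeries, one_mul]

lemma thetaBesselTerm_I (k : ℕ) : thetaBesselTerm k Complex.I = thetaJTerm k := by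
  funext X Y θ n
  simp only [thetaBesselTerm, thetaJTerm, besselJAt, besselSeries, mul_div_assoc Complex.I, mul_pow,
    pow_mul Complex.I, Complex.I_sq]

variable {k : ℕ} {e : ℂ}

lemma thetaBesselTerm_eq (hk : 1 ≤ k) (e X Y : ℂ) (θ : ℝ) (n : ℕ+) :
    thetaBesselTerm k e X Y θ n = thetaConst k Y θ *
      ((sumSqReps k n : ℂ) * segmentMean (betaMeasure (k / 4) (k / 4))
        (fun τ => Complex.exp (-((π * (n : ℕ) : ℝ) * τ))) (X + e * Y) (X - e * Y)) := by
  have hGamma : Complex.Gamma (k / 4 + 1 / 2) ≠ 0 :=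
    Complex.Gamma_ne_zero_of_re_pos (by
      rw [show (k / 4 + 1 / 2 : ℂ) = ((k / 4 + 1 / 2 : ℝ) : ℂ) by push_cast; rfl,
        Complex.ofReal_re]
      positivity)
  have hpowAt : powAt (π * (n : ℕ) * Y / 2) θ (k / 4 - 1 / 2) =
      ((n : ℕ) : ℂ) ^ (k / 4 - 1 / 2 : ℂ) * powAt (π * Y / 2) θ (k / 4 - 1 / 2) := by
    rw [← Complex.ofReal_natCast, ← powAt_ofReal_mul (Nat.cast_nonneg _)]
    congr 1
    ring
  rw [thetaBesselTerm, thetaConst_eq, hpowAt, segmentMean_exp_neg_mul_betaMeasure (by positivity),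
    mul_left_comm e]
  push_cast
  generalize Complex.Gamma (k / 4 + 1 / 2) = G at hGamma ⊢
  field_simp

lemma hasSum_thetaBesselTerm (hk : 1 ≤ k) {X Y : ℂ} (θ : ℝ) (hw : X + e * Y ∈ rightHalfPlane)
    (hw' : X - e * Y ∈ rightHalfPlane) :
    HasSum (thetaBesselTerm k e X Y θ)
      (thetaConst k Y θ * (thetaPowMean k (X + e * Y) (X - e * Y) - 1)) :=
  ((hasSum_thetaPowMean hk hw hw').mul_left _).congr_fun (thetaBesselTerm_eq hk e X Y θ)

theorem thetaBesselTerm_transformation (hk : 1 ≤ k) {x y D : ℂ} (θ : ℝ)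
    (hw : x + e * y ∈ rightHalfPlane) (hw' : x - e * y ∈ rightHalfPlane)
    (hD : D = (x + e * y) * (x - e * y)) :
    Summable (thetaBesselTerm k e x y θ) ∧
      Summable (thetaBesselTerm k e (x / D) (y / D) (θ - D.arg)) ∧
      thetaConst k y θ + ∑' n, thetaBesselTerm k e x y θ n =
        thetaConst k y θ / D ^ (k / 4 : ℂ) + 1 / D ^ (1 / 2 : ℂ) *
          ∑' n, thetaBesselTerm k e (x / D) (y / D) (θ - D.arg) n := by
  have hne := ne_zero_of_mem_rightHalfPlane hw
  have hne' := ne_zero_of_mem_rightHalfPlane hw'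
  have hD0 : D ≠ 0 := hD ▸ mul_ne_zero hne hne'
  have hadd : x / D + e * (y / D) = (x - e * y)⁻¹ := by
    rw [hD]
    field_simp
  have hsub : x / D - e * (y / D) = (x + e * y)⁻¹ := by
    rw [hD]
    field_simp
  have hleft := hasSum_thetaBesselTerm (e := e) hk θ hw hw'
  have hright := hasSum_thetaBesselTerm (e := e) (X := x / D) (Y := y / D) hk (θ - D.arg)
    (hadd ▸ inv_mem_rightHalfPlane hw') (hsub ▸ inv_mem_rightHalfPlane hw)
  refine ⟨hleft.summable, hright.summable, ?_⟩
  have hpow : D ^ (k / 4 : ℂ) = D ^ (1 / 2 : ℂ) * D ^ (k / 4 - 1 / 2 : ℂ) := by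
    rw [← Complex.cpow_add _ _ hD0, add_sub_cancel]
  have hpow0 (c : ℂ) : D ^ c ≠ 0 := by simp [Complex.cpow_eq_zero_iff, hD0]
  have hhalf := hpow0 (1 / 2)
  have hν := hpow0 (k / 4 - 1 / 2)
  rw [hleft.tsum_eq, hright.tsum_eq, hadd, hsub,
    thetaPowMean_swap hk (x - e * y)⁻¹, thetaPowMean_inv hk hw hw', ← hD, thetaConst_div k y hD0,
    hpow]
  generalize D ^ (1 / 2 : ℂ) = r at hhalf ⊢
  generalize D ^ (k / 4 - 1 / 2 : ℂ) = t at hν ⊢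
  field_simp
  ring

end BesselSeries

end

theorem corollary1 (k : ℕ) (hk : 1 ≤ k) (x y : ℂ) (hy : k = 1 → y ≠ 0)
    (θ : ℝ) (hθ : IsArgOf θ y) :
    (|y.im| < x.re →
      Summable (thetaJTerm k x y θ) ∧
      Summable (thetaJTerm k (x / (x ^ 2 + y ^ 2)) (y / (x ^ 2 + y ^ 2))
        (θ - (x ^ 2 + y ^ 2).arg)) ∧
      thetaConst k y θ + ∑' n : ℕ+, thetaJTerm k x y θ n =
        thetaConst k y θ / (x ^ 2 + y ^ 2) ^ ((k : ℂ) / 4) +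
          1 / (x ^ 2 + y ^ 2) ^ (1 / 2 : ℂ) *
            ∑' n : ℕ+, thetaJTerm k (x / (x ^ 2 + y ^ 2)) (y / (x ^ 2 + y ^ 2))
              (θ - (x ^ 2 + y ^ 2).arg) n) ∧
    (|y.re| < x.re →
      Summable (thetaITerm k x y θ) ∧
      Summable (thetaITerm k (x / (x ^ 2 - y ^ 2)) (y / (x ^ 2 - y ^ 2))
        (θ - (x ^ 2 - y ^ 2).arg)) ∧
      thetaConst k y θ + ∑' n : ℕ+, thetaITerm k x y θ n =
        thetaConst k y θ / (x ^ 2 - y ^ 2) ^ ((k : ℂ) / 4) +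
          1 / (x ^ 2 - y ^ 2) ^ (1 / 2 : ℂ) *
            ∑' n : ℕ+, thetaITerm k (x / (x ^ 2 - y ^ 2)) (y / (x ^ 2 - y ^ 2))
              (θ - (x ^ 2 - y ^ 2).arg) n) := by
  constructor
  · intro h
    obtain ⟨hneg, hpos⟩ := abs_lt.1 h
    rw [← thetaBesselTerm_I]
    refine thetaBesselTerm_transformation hk θ ?_ ?_ (by linear_combination y ^ 2 * Complex.I_sq)
    · rw [mem_rightHalfPlane, Complex.add_re, Complex.I_mul_re]
      linarith
    · rw [mem_rightHalfPlane, Complex.sub_re, Complex.I_mul_re]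
      linarith
  · intro h
    obtain ⟨hneg, hpos⟩ := abs_lt.1 h
    rw [← thetaBesselTerm_one]
    refine thetaBesselTerm_transformation hk θ ?_ ?_ (by ring)
    · rw [mem_rightHalfPlane, Complex.add_re, one_mul]
      linarith
    · rw [mem_rightHalfPlane, Complex.sub_re, one_mul]
      linarith
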